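/- Let $K$ be a field, $n\ge 2$, and $S=K[x_1,\dots,x_n]$. For $1\le m<n$ let $J_{n,m}\subset S$ be the $m$-path ideal of the cycle graph of length $n$, that is, the ideal generated by the $n$ monomials $x_ix_{i+1}\cdots x_{i+m-1}$ $(1\le i\le n)$, where indices are taken modulo $n$. For a proper monomial ideal $I\subset S$, $\operatorname{depth}(S/I)$ is the maximal length of an $S/I$-regular sequence contained in $(x_1,\dots,x_n)$. A Stanley decomposition of $S/I$ is a decomposition $\mathcal D:\ S/I=\bigoplus_{i=1}^r u_iK[Z_i]$ as $\mathbb Z^n$-graded $K$-vector spaces, where the $u_i\in S$ are monomials and $Z_i\subset\{x_1,\dots,x_n\}$; put $\operatorname{sdepth}(\mathcal D)=\min_i|Z_i|$, and let $\operatorname{sdepth}(S/I)$ be the maximum of $\operatorname{sdepth}(\mathcal D)$ over all Stanley decompositions $\mathcal D$ of $S/I$. Then: 1. For all $n\ge 2$ and $t\ge n-1$, $\operatorname{sdepth}(S/J_{n,n-1}^t)=\operatorname{depth}(S/J_{n,n-1}^t)=0$. 2. If $n\ge 3$ is odd, then $\operatorname{sdepth}(S/J_{n,n-2}^t)=\operatorname{depth}(S/J_{n,n-2}^t)=0$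 for all $t\ge \frac{n-1}{2}$. 3. If $n\ge 3$ is even, then $\frac n2\ge \operatorname{sdepth}(S/J_{n,n-2}^t)\ge \operatorname{depth}(S/J_{n,n-2}^t)=1$ for all $t\ge n-1$. -/

import Mathlib

noncomputable section

/-- The `m`-path ideal `J_{n,m}` of the cycle graph of length `n` in `S = K[x_1, …, x_n]`, with the
variables indexed by `Fin n`: it is generated by the `n` products of `m` cyclically consecutive
variables. -/
def cyclePathIdeal (K : Type*) [Field K] (n m : ℕ) : Ideal (MvPolynomial (Fin n) K) :=
  Ideal.span (Set.range fun i : Fin n =>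
    ∏ k ∈ Finset.range m,
      (MvPolynomial.X (⟨(i.val + k) % n, Nat.mod_lt _ i.pos⟩ : Fin n) : MvPolynomial (Fin n) K))

/-- The depth of a graded `K[x_1, …, x_n]`-module `M`: the supremum of the lengths of the
`M`-regular sequences of elements of the ideal `(x_1, …, x_n)`. -/
def polyDepth (K : Type*) [Field K] (n : ℕ) (M : Type*) [AddCommGroup M]
    [Module (MvPolynomial (Fin n) K) M] : ℕ∞ :=
  ⨆ rs : {rs : List (MvPolynomial (Fin n) K) //
      (∀ f ∈ rs, f ∈ Ideal.span (Set.range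
        (MvPolynomial.X : Fin n → MvPolynomial (Fin n) K))) ∧
      RingTheory.Sequence.IsRegular M rs}, (rs.val.length : ℕ∞)

/-- The `K`-subspace `x^a K[Z]` of `S = K[x_1, …, x_n]`. -/
def stanleySpace (K : Type*) [Field K] {n : ℕ} (a : Fin n →₀ ℕ) (Z : Finset (Fin n)) :
    Submodule K (MvPolynomial (Fin n) K) :=
  (Subalgebra.toSubmodule (MvPolynomial.supported K (Z : Set (Fin n)))).map
    (LinearMap.mulLeft K (MvPolynomial.monomial a (1 : K)))

/-- A Stanley decomposition `S/I = ⨁ i, x^{a_i} K[Z_i]` of the quotient of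
`S = K[x_1, …, x_n]` by a monomial ideal `I`, with finitely many summands. Each summand
`x^{a_i} K[Z_i]` embeds in `S/I`, and `S/I` is the internal direct sum of the images. -/
structure StanleyDecomposition {K : Type*} [Field K] {n : ℕ}
    (I : Ideal (MvPolynomial (Fin n) K)) where
  /-- The number of summands. -/
  r : ℕ
  /-- The exponents of the monomials. -/
  a : Fin r → Fin n →₀ ℕ
  /-- The sets of variables. -/
  Z : Fin r → Finset (Fin n)
  embeds : ∀ i, Set.InjOn (Ideal.Quotient.mk I)
    (stanleySpace K (a i) (Z i) : Set (MvPolynomial (Fin n) K))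
  isInternal : DirectSum.IsInternal fun i =>
    (stanleySpace K (a i) (Z i)).map (Ideal.Quotient.mkₐ K I).toLinearMap

/-- The Stanley depth of a Stanley decomposition: the least of the numbers `|Z_i|`. -/
def StanleyDecomposition.sdepth {K : Type*} [Field K] {n : ℕ}
    {I : Ideal (MvPolynomial (Fin n) K)} (D : StanleyDecomposition I) : ℕ∞ :=
  ⨅ i, ((D.Z i).card : ℕ∞)

/-- The Stanley depth of `S/I`, for a monomial ideal `I ≠ S`: the greatest Stanley depth of a
Stanley decomposition of `S/I`. -/
def stanleyDepth {K : Type*} [Field K] {n : ℕ} (I : Ideal (MvPolynomial (Fin n) K)) : ℕ∞ :=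
  ⨆ D : StanleyDecomposition I, D.sdepth

end

open MvPolynomial
open scoped Pointwise

/-! A generator of `J_{n,n-1}` omits one vertex of the cycle, a generator of `J_{n,n-2}` omits the
two ends of one edge. Hence x^c lies in the t-th power exactly when the demands max(t - c_v, 0) can
be met by a total weight t, placed on the vertices in the first case and on the edges in the second
(`monomial_mem_pow_pred_iff`, `monomial_mem_pow_pred_pred_iff`).

In the two vanishing cases, demands of total t + 1 (vertices) or 2t + 1 (edges of an odd cycle) give
a monomial outside the power that every variable multiplies into it. Such a socle monomial forces
depth 0, and the Stanley space containing it has no free variable.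

On an even cycle the demands are chosen with total t + 1 on each colour class. The monomial stays
outside as long as one class is untouched, but enters the power once a vertex of each class is
raised (`exists_disconnecting_monomial`). So the free variables at this monomial lie in one class,
which bounds the Stanley depth by n/2. Multiplying the variables of one class by x^c and those of
the other by 0 defines a map (x_1, …, x_n) → S/I that is no multiplication by an element, so the
depth is at most 1.

For the lower bounds, an even cycle is bipartite, so by Egerváry's theorem only independent sets
obstruct a cover. Such a set misses vertex 0 or vertex 1, so a monomial outside the power stays
outside under all powers of x_0 or all powers of x_1. This makes x_0 + x_1 a nonzerodivisor and
yields a Stanley decomposition in which every summand has a free variable. -/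

/-- A monomial ideal: with every polynomial it contains all monomials of its support. -/
def IsMonomialIdeal {σ K : Type*} [Field K] (I : Ideal (MvPolynomial σ K)) : Prop :=
  ∀ f ∈ I, ∀ c ∈ f.support, monomial c (1 : K) ∈ I

/-! ### Monomial ideals. -/

section MonomialIdeal

variable {σ K : Type*} [Field K] {I : Ideal (MvPolynomial σ K)}

theorem IsMonomialIdeal.mem_iff (hI : IsMonomialIdeal I) (f : MvPolynomial σ K) :
    f ∈ I ↔ ∀ c ∈ f.support, monomial c (1 : K) ∈ I := by
  refine ⟨hI f, fun h => ?_⟩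
  rw [f.as_sum]
  refine Ideal.sum_mem _ fun c hc => ?_
  have := I.mul_mem_left (C (coeff c f)) (h c hc)
  rwa [C_mul_monomial, mul_one] at this

theorem monomial_mem_span_iff (s : Set (σ →₀ ℕ)) (c : σ →₀ ℕ) :
    monomial c (1 : K) ∈ Ideal.span ((fun a => monomial a (1 : K)) '' s) ↔ ∃ a ∈ s, a ≤ c := by
  classical
  rw [mem_ideal_span_monomial_image, support_monomial, if_neg one_ne_zero]
  simp

theorem isMonomialIdeal_span (s : Set (σ →₀ ℕ)) :
    IsMonomialIdeal (Ideal.span ((fun a => monomial a (1 : K)) '' s)) := by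
  intro f hf c hc
  rw [mem_ideal_span_monomial_image] at hf
  exact (monomial_mem_span_iff s c).2 (hf c hc)

theorem monomial_mem_of_le {a c : σ →₀ ℕ} (h : a ≤ c) (ha : monomial a (1 : K) ∈ I) :
    monomial c (1 : K) ∈ I := by
  obtain ⟨b, rfl⟩ := exists_add_of_le h
  have := I.mul_mem_right (monomial b 1) ha
  rwa [monomial_mul, one_mul] at this

theorem IsMonomialIdeal.coeff_eq_zero (hI : IsMonomialIdeal I) {f : MvPolynomial σ K} (hf : f ∈ I)
    {c : σ →₀ ℕ} (hc : monomial c (1 : K) ∉ I) : coeff c f = 0 := by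
  by_contra h
  exact hc (hI f hf c (mem_support_iff.2 h))

end MonomialIdeal

/-! ### Stanley decompositions as partitions of monomials into cones. -/

section StanleyDepth

variable {K : Type*} [Field K] {n : ℕ} {I : Ideal (MvPolynomial (Fin n) K)}

theorem stanleySpace_eq_restrictSupport (a : Fin n →₀ ℕ) (Z : Finset (Fin n)) :
    stanleySpace K a Z = restrictSupport K {c | a ≤ c ∧ ∀ v ∉ Z, c v = a v} := by
  apply le_antisymm
  · rintro _ ⟨g, hg, rfl⟩
    rw [mem_restrictSupport_iff]
    intro c hc
    have hc' : coeff c (monomial a (1 : K) * g) ≠ 0 := mem_support_iff.1 hc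
    rw [coeff_monomial_mul'] at hc'
    split_ifs at hc' with hac
    · refine ⟨hac, fun v hv => ?_⟩
      by_contra hne
      have hg' : (g.vars : Set (Fin n)) ⊆ Z := mem_supported.1 hg
      refine hv (hg' ((mem_vars_iff_mem_support v).2 ⟨c - a, ?_, ?_⟩))
      · rw [mem_support_iff]; intro h0; simp [h0] at hc'
      · rw [Finsupp.mem_support_iff, Finsupp.tsub_apply]
        have := hac v
        omega
    · exact absurd rfl hc'
  · rw [restrictSupport_eq_span, Submodule.span_le]
    rintro _ ⟨c, ⟨hac, hc⟩, rfl⟩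
    refine ⟨monomial (c - a) 1, ?_, ?_⟩
    · change monomial (c - a) (1 : K) ∈ supported K (Z : Set (Fin n))
      rw [mem_supported, vars_monomial one_ne_zero]
      intro v hv
      by_contra hvZ
      have := hc v hvZ
      simp [this] at hv
    · simp [monomial_mul, add_tsub_cancel_of_le hac]

theorem mem_stanleySpace_iff {a : Fin n →₀ ℕ} {Z : Finset (Fin n)} {f : MvPolynomial (Fin n) K} :
    f ∈ stanleySpace K a Z ↔ ∀ c ∈ f.support, a ≤ c ∧ ∀ v ∉ Z, c v = a v := by
  rw [stanleySpace_eq_restrictSupport, mem_restrictSupport_iff]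
  rfl

theorem monomial_mem_stanleySpace {a c : Fin n →₀ ℕ} {Z : Finset (Fin n)} :
    monomial c (1 : K) ∈ stanleySpace K a Z ↔ a ≤ c ∧ ∀ v ∉ Z, c v = a v := by
  classical
  rw [mem_stanleySpace_iff, support_monomial, if_neg one_ne_zero]
  simp

/-- A lift f of the class of x^c to the sum of the Stanley spaces differs from x^c by an element of
I. As x^c ∉ I, f has coefficient 1 at c, so one of these monomial subspaces contains x^c. -/
theorem StanleyDecomposition.exists_mem (D : StanleyDecomposition I) (hI : IsMonomialIdeal I)
    {c : Fin n →₀ ℕ} (hc : monomial c (1 : K) ∉ I) :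
    ∃ i, monomial c (1 : K) ∈ stanleySpace K (D.a i) (D.Z i) := by
  classical
  have htop := D.isInternal.submodule_iSup_eq_top
  have hmem : (Ideal.Quotient.mkₐ K I).toLinearMap (monomial c 1) ∈
      ⨆ i, (stanleySpace K (D.a i) (D.Z i)).map (Ideal.Quotient.mkₐ K I).toLinearMap := by
    rw [htop]; trivial
  rw [← Submodule.map_iSup] at hmem
  obtain ⟨f, hf, hfc⟩ := hmem
  have hdiff : f - monomial c 1 ∈ I := by
    rw [← Ideal.Quotient.eq]; exact hfc
  have hcoeff : coeff c f = 1 := by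
    have := hI.coeff_eq_zero hdiff hc
    rw [coeff_sub, coeff_monomial, if_pos rfl] at this
    exact sub_eq_zero.1 this
  by_contra! hno
  have hle : (⨆ i, stanleySpace K (D.a i) (D.Z i)) ≤ restrictSupport K {c}ᶜ := by
    refine iSup_le fun i g hg => ?_
    rw [mem_restrictSupport_iff]
    rintro b hb rfl
    exact hno i (monomial_mem_stanleySpace.2 (mem_stanleySpace_iff.1 hg _ hb))
  have := (mem_restrictSupport_iff K).1 (hle hf)
    (mem_support_iff.2 (by simp [hcoeff] : coeff c f ≠ 0))
  exact this rfl

/-- The summand containing x^c also contains every x^(c+e) with e supported in Z, and it meets I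
only in 0. A single monomial thus bounds all decompositions at once. -/
theorem stanleyDepth_le (hI : IsMonomialIdeal I) {c : Fin n →₀ ℕ} {k : ℕ}
    (hc : monomial c (1 : K) ∉ I)
    (hk : ∀ Z : Finset (Fin n),
      (∀ e : Fin n →₀ ℕ, e.support ⊆ Z → monomial (c + e) (1 : K) ∉ I) → Z.card ≤ k) :
    stanleyDepth I ≤ k := by
  refine iSup_le fun D => ?_
  obtain ⟨i, hi⟩ := D.exists_mem hI hc
  refine (iInf_le _ i).trans ?_
  rw [Nat.cast_le]
  refine hk _ fun e he hmem => ?_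
  obtain ⟨hac, hcZ⟩ := monomial_mem_stanleySpace.1 hi
  have hin : monomial (c + e) (1 : K) ∈ stanleySpace K (D.a i) (D.Z i) := by
    refine monomial_mem_stanleySpace.2 ⟨hac.trans le_self_add, fun v hv => ?_⟩
    have : e v = 0 := by
      by_contra h
      exact hv (he (Finsupp.mem_support_iff.2 h))
    rw [Finsupp.add_apply, this, add_zero, hcZ v hv]
  have := D.embeds i hin (Submodule.zero_mem _)
    (by rw [map_zero]; exact Ideal.Quotient.eq_zero_iff_mem.2 hmem)
  exact one_ne_zero (monomial_eq_zero.1 this)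

/-- A partition of the monomials outside a monomial ideal into finitely many cones gives a Stanley
decomposition. -/
theorem exists_stanleyDecomposition (hI : IsMonomialIdeal I) {ι : Type*} [Fintype ι]
    (a : ι → Fin n →₀ ℕ) (Z : ι → Finset (Fin n))
    (hdisj : ∀ i c, (a i ≤ c ∧ ∀ v ∉ Z i, c v = a i v) → monomial c (1 : K) ∉ I)
    (hex : ∀ c, monomial c (1 : K) ∉ I → ∃ i, a i ≤ c ∧ ∀ v ∉ Z i, c v = a i v)
    (huniq : ∀ i j c, (a i ≤ c ∧ ∀ v ∉ Z i, c v = a i v) →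
      (a j ≤ c ∧ ∀ v ∉ Z j, c v = a j v) → i = j) :
    ∃ D : StanleyDecomposition I, ∀ i, ∃ j, D.Z i = Z j := by
  classical
  let e := Fintype.equivFin ι
  refine ⟨⟨Fintype.card ι, fun i => a (e.symm i), fun i => Z (e.symm i), ?_, ?_⟩,
    fun i => ⟨e.symm i, rfl⟩⟩
  · intro i f hf g hg hfg
    have hfg' : f - g ∈ I := Ideal.Quotient.eq.1 hfg
    have hs := mem_stanleySpace_iff.1 (Submodule.sub_mem _ hf hg)
    rw [← sub_eq_zero, ← support_eq_empty, Finset.eq_empty_iff_forall_notMem]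
    exact fun c hc => hdisj _ c (hs c hc) (hI _ hfg' c hc)
  · rw [DirectSum.isInternal_submodule_iff_iSupIndep_and_iSup_eq_top]
    constructor
    · rw [iSupIndep_def]
      intro i
      rw [Submodule.disjoint_def]
      intro x hx hx'
      obtain ⟨f, hf, rfl⟩ := hx
      simp only [← Submodule.map_iSup] at hx'
      obtain ⟨g, hg, hgf⟩ := hx'
      have hfg : f - g ∈ I := by
        rw [← Ideal.Quotient.eq]; exact hgf.symm
      -- The support of g avoids the i-th cone, so on that cone f - g ∈ I has the coefficients of f,
      -- and these vanish because the cone lies outside I.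
      have hg' : g ∈ restrictSupport K
          {c | ¬ (a (e.symm i) ≤ c ∧ ∀ v ∉ Z (e.symm i), c v = a (e.symm i) v)} := by
        have hle : (⨆ (j) (_ : j ≠ i), stanleySpace K (a (e.symm j)) (Z (e.symm j))) ≤
            restrictSupport K
              {c | ¬ (a (e.symm i) ≤ c ∧ ∀ v ∉ Z (e.symm i), c v = a (e.symm i) v)} := ?_
        · exact hle hg
        refine iSup_le fun j => iSup_le fun hji h hh => ?_
        rw [mem_restrictSupport_iff]
        intro c hc hc'
        exact hji (e.symm.injective (huniq _ _ c (mem_stanleySpace_iff.1 hh c hc) hc'))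
      have hf0 : f = 0 := by
        rw [← support_eq_empty, Finset.eq_empty_iff_forall_notMem]
        intro c hc
        have hcone := mem_stanleySpace_iff.1 hf c hc
        have hgc : coeff c g = 0 := by
          by_contra h
          exact ((mem_restrictSupport_iff K).1 hg' (mem_support_iff.2 h)) hcone
        refine mem_support_iff.1 hc ?_
        have := hI.coeff_eq_zero hfg (hdisj _ c hcone)
        rwa [coeff_sub, hgc, sub_zero] at this
      rw [hf0, map_zero]
    · rw [← Submodule.map_iSup, eq_top_iff]
      rintro x -
      obtain ⟨f, rfl⟩ := Ideal.Quotient.mk_surjective x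
      induction f using MvPolynomial.induction_on' with
      | monomial c r =>
        by_cases hc : monomial c (1 : K) ∈ I
        · have : monomial c r ∈ I := by
            have := I.mul_mem_left (C r) hc
            rwa [C_mul_monomial, mul_one] at this
          rw [Ideal.Quotient.eq_zero_iff_mem.2 this]
          exact Submodule.zero_mem _
        · obtain ⟨i, hi⟩ := hex c hc
          refine ⟨monomial c r, Submodule.mem_iSup_of_mem (e i) ?_, rfl⟩
          rw [mem_stanleySpace_iff, Equiv.symm_apply_apply]
          intro b hb
          rwa [Finset.mem_singleton.1 (support_monomial_subset hb)]
      | add p q hp hq => rw [map_add]; exact Submodule.add_mem _ hp hq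

end StanleyDepth

/-! ### Monomial criteria for depth 0, depth at most 1 and depth at least 1. -/

section Depth

variable {K : Type*} [Field K] {n : ℕ} {I : Ideal (MvPolynomial (Fin n) K)}

theorem mul_mem_of_forall_X_mul_mem {σ : Type*} {I : Ideal (MvPolynomial σ K)}
    {s : Set σ} {u f : MvPolynomial σ K} (hf : f ∈ Ideal.span (X '' s))
    (h : ∀ i ∈ s, X i * u ∈ I) : f * u ∈ I := by
  have : Ideal.span (X '' s) ≤ Submodule.comap (LinearMap.mulRight _ u) I := by
    rw [Ideal.span_le]
    rintro _ ⟨i, hi, rfl⟩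
    exact h i hi
  exact this hf

theorem X_mul_monomial_mem_iff {σ : Type*} {I : Ideal (MvPolynomial σ K)} (i : σ) (c : σ →₀ ℕ) :
    X i * monomial c (1 : K) ∈ I ↔ monomial (c + Finsupp.single i 1) (1 : K) ∈ I := by
  rw [X, monomial_mul, one_mul, add_comm]

/-- The class of x^c is a nonzero socle element: it is killed by the whole ideal (x_1, …, x_n), so
no regular sequence can start. -/
theorem polyDepth_eq_zero {c : Fin n →₀ ℕ} (hc : monomial c (1 : K) ∉ I)
    (h : ∀ i, monomial (c + Finsupp.single i 1) (1 : K) ∈ I) :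
    polyDepth K n (MvPolynomial (Fin n) K ⧸ I) = 0 := by
  rw [← nonpos_iff_eq_zero]
  refine iSup_le ?_
  rintro ⟨rs, hrs, hreg⟩
  match rs with
  | [] => simp
  | f :: rs =>
    exfalso
    have hf := hrs f (by simp)
    rw [← Set.image_univ] at hf
    have hreg := ((RingTheory.Sequence.isRegular_cons_iff _ _ _).1 hreg).1
    refine hc ((Ideal.Quotient.eq_zero_iff_mem).1 (hreg ?_))
    change f • Ideal.Quotient.mk I (monomial c 1) = f • (0 : MvPolynomial (Fin n) K ⧸ I)
    rw [smul_zero, ← Ideal.Quotient.mk_eq_mk, ← Submodule.Quotient.mk_smul,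
      Submodule.Quotient.mk_eq_zero, smul_eq_mul]
    exact mul_mem_of_forall_X_mul_mem hf fun i _ => (X_mul_monomial_mem_iff i c).2 (h i)

/-- If two elements `f`, `g` of an ideal `m` form a regular sequence on `M`, then every
homomorphism `m → M` is the multiplication by an element of `M`. -/
theorem exists_eq_smul_of_regular_pair {R M : Type*} [CommRing R] [AddCommGroup M] [Module R M]
    {m : Ideal R} {f g : R} (hf : f ∈ m) (hg : g ∈ m) (hfreg : IsSMulRegular M f)
    (hgreg : IsSMulRegular (QuotSMulTop f M) g) (φ : R → M)
    (hφ : ∀ r ∈ m, ∀ s ∈ m, r • φ s = s • φ r) : ∃ x : M, ∀ r ∈ m, φ r = r • x := by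
  -- Modulo f, g • φ f = f • φ g vanishes, and g is regular there.
  have hmem : φ f ∈ (f • ⊤ : Submodule R M) := by
    rw [← Submodule.Quotient.mk_eq_zero]
    refine hgreg ?_
    change g • _ = g • _
    rw [smul_zero, ← Submodule.Quotient.mk_smul, Submodule.Quotient.mk_eq_zero, hφ g hg f hf]
    exact Submodule.smul_mem_pointwise_smul _ _ _ trivial
  obtain ⟨x, -, hx⟩ := (Submodule.mem_smul_pointwise_iff_exists _ _ _).1 hmem
  refine ⟨x, fun r hr => hfreg ?_⟩
  change f • _ = f • _
  rw [hφ f hf r hr, ← hx, smul_comm]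

/-- Setting the variables of A to 0 splits an element of the maximal ideal into a part in (x_i : i ∈
A), treated here, and a part in (x_j : j ∉ A), treated in `aeval_mem_span`. -/
theorem sub_aeval_mem_span {σ : Type*} (A : Set σ) [DecidablePred (· ∈ A)]
    (f : MvPolynomial σ K) :
    f - aeval (fun v => if v ∈ A then 0 else X v) f ∈ Ideal.span (X '' A) := by
  rw [← Ideal.Quotient.eq]
  refine DFunLike.congr_fun (f := Ideal.Quotient.mkₐ K (Ideal.span (X '' A)))
    (g := (Ideal.Quotient.mkₐ K _).comp (aeval fun v => if v ∈ A then 0 else X v))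
    (MvPolynomial.algHom_ext fun v => ?_) f
  rw [AlgHom.comp_apply, aeval_X]
  split_ifs with hv
  · rw [map_zero]
    exact Ideal.Quotient.eq_zero_iff_mem.2 (Ideal.subset_span ⟨v, hv, rfl⟩)
  · rfl

theorem aeval_mem_span {σ : Type*} (A : Set σ) [DecidablePred (· ∈ A)]
    {f : MvPolynomial σ K} (hf : f ∈ Ideal.span (Set.range X)) :
    aeval (fun v => if v ∈ A then 0 else X v) f ∈
      Ideal.span (X '' Aᶜ : Set (MvPolynomial σ K)) := by
  have : Ideal.span (Set.range X) ≤ Ideal.comap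
      (aeval (fun v => if v ∈ A then 0 else X v) : MvPolynomial σ K →ₐ[K] MvPolynomial σ K)
      (Ideal.span (X '' Aᶜ : Set (MvPolynomial σ K))) := by
    rw [Ideal.span_le]
    rintro _ ⟨v, rfl⟩
    rw [SetLike.mem_coe, Ideal.mem_comap, aeval_X]
    split_ifs with hv
    · exact Ideal.zero_mem _
    · exact Ideal.subset_span ⟨v, hv, rfl⟩
  exact this hf

/-- A monomial witness for `S/I` having depth at most one: outside `I`, the monomial `x^c` has a
disconnected set of directions. -/
theorem polyDepth_le_one (hI : IsMonomialIdeal I) {c : Fin n →₀ ℕ} (A : Set (Fin n))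
    {i₀ j₀ : Fin n} (hi₀ : i₀ ∈ A) (hj₀ : j₀ ∉ A)
    (hi : monomial (c + Finsupp.single i₀ 1) (1 : K) ∉ I)
    (hj : monomial (c + Finsupp.single j₀ 1) (1 : K) ∉ I)
    (h : ∀ i ∈ A, ∀ j ∉ A,
      monomial (c + Finsupp.single i 1 + Finsupp.single j 1) (1 : K) ∈ I) :
    polyDepth K n (MvPolynomial (Fin n) K ⧸ I) ≤ 1 := by
  classical
  refine iSup_le ?_
  rintro ⟨rs, hrs, hreg⟩
  match rs with
  | [] => simp
  | [f] => simp
  | f :: g :: rs =>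
    exfalso
    rw [RingTheory.Sequence.isRegular_cons_iff, RingTheory.Sequence.isRegular_cons_iff] at hreg
    let ρ : MvPolynomial (Fin n) K →ₐ[K] MvPolynomial (Fin n) K :=
      aeval (fun v => if v ∈ A then 0 else X v)
    have hprod : ∀ r, ∀ s ∈ Ideal.span (Set.range (X : Fin n → MvPolynomial (Fin n) K)),
        monomial c 1 * ((r - ρ r) * ρ s) ∈ I := by
      intro r s hs
      rw [mul_comm, mul_assoc]
      refine mul_mem_of_forall_X_mul_mem (sub_aeval_mem_span A r) fun i hi => ?_
      rw [mul_left_comm]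
      refine mul_mem_of_forall_X_mul_mem (aeval_mem_span A hs) fun j hj => ?_
      rw [X, X, monomial_mul, monomial_mul, one_mul, one_mul]
      convert h i hi j hj using 3
      abel
    -- The map r ↦ x^c (r - ρ r) sends x_i to x^c x_i for i ∈ A and x_j to 0 for j ∉ A. A
    -- representative y of x would need coefficient 0 at c because of x_{j₀} and coefficient 1
    -- because of x_{i₀}.
    obtain ⟨x, hx⟩ := exists_eq_smul_of_regular_pair (hrs f (by simp)) (hrs g (by simp))
      hreg.1 hreg.2.1 (fun r => Ideal.Quotient.mk I (monomial c 1 * (r - ρ r))) (by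
        intro r hr s hs
        change Ideal.Quotient.mk I (r * (monomial c 1 * (s - ρ s))) =
          Ideal.Quotient.mk I (s * (monomial c 1 * (r - ρ r)))
        rw [Ideal.Quotient.eq]
        convert Ideal.sub_mem _ (hprod s r hr) (hprod r s hs) using 1
        ring)
    obtain ⟨y, rfl⟩ := Ideal.Quotient.mk_surjective x
    have hXi := hx (X i₀) (Ideal.subset_span ⟨_, rfl⟩)
    have hXj := hx (X j₀) (Ideal.subset_span ⟨_, rfl⟩)
    simp only [ρ, aeval_X, if_pos hi₀, if_neg hj₀, sub_zero, sub_self, mul_zero] at hXi hXj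
    change Ideal.Quotient.mk I _ = Ideal.Quotient.mk I (_ * y) at hXi hXj
    rw [Ideal.Quotient.eq] at hXi hXj
    have hcj : coeff c y = 0 := by
      have := hI.coeff_eq_zero hXj hj
      rw [add_comm] at this
      simpa [coeff_X_mul] using this
    have hci := hI.coeff_eq_zero hXi hi
    rw [mul_comm (monomial c 1), ← mul_sub, add_comm, coeff_X_mul, coeff_sub, hcj,
      coeff_monomial, if_pos rfl, sub_zero] at hci
    exact one_ne_zero hci

/-- `x_p + x_q` is a nonzerodivisor modulo a monomial ideal whose saturations with respect to `x_p`
and `x_q` have no more in common than the ideal. -/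
theorem mem_of_X_add_X_mul_mem {σ : Type*} {I : Ideal (MvPolynomial σ K)} (hI : IsMonomialIdeal I)
    {p q : σ} (hpq : p ≠ q)
    (h : ∀ c : σ →₀ ℕ, monomial c (1 : K) ∉ I →
      (∀ k, monomial (c + Finsupp.single p k) (1 : K) ∉ I) ∨
        ∀ k, monomial (c + Finsupp.single q k) (1 : K) ∉ I)
    {g : MvPolynomial σ K} (hg : (X p + X q) * g ∈ I) : g ∈ I := by
  classical
  have key : ∀ p q : σ, p ≠ q → (X p + X q) * g ∈ I → ∀ c ∈ g.support,
      ∃ k, monomial (c + Finsupp.single p k) (1 : K) ∈ I := by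
    intro p q hpq hg
    by_contra! hbad
    obtain ⟨c₀, hc₀, hc₀'⟩ := hbad
    -- Take a bad c with maximal p-exponent. The coefficient of the product at c + e_p is g_c +
    -- g_{c'} with c' = c + e_p - e_q, and it is 0, so c' is in the support too. If c' is bad,
    -- maximality fails; if not, a power of x_p brings x^c into I as well.
    obtain ⟨c, hc, hmax⟩ := Finset.exists_max_image
      (g.support.filter fun c => ∀ k, monomial (c + Finsupp.single p k) (1 : K) ∉ I)
      (fun c => c p) ⟨c₀, Finset.mem_filter.2 ⟨hc₀, hc₀'⟩⟩
    rw [Finset.mem_filter] at hc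
    have h0 := hI.coeff_eq_zero hg (hc.2 1)
    rw [add_mul, coeff_add, add_comm c, coeff_X_mul, coeff_X_mul'] at h0
    split_ifs at h0 with hq
    · have hq' : 1 ≤ c q := by
        rw [Finsupp.mem_support_iff, Finsupp.add_apply, Finsupp.single_eq_of_ne' hpq] at hq
        omega
      have hle : Finsupp.single q 1 ≤ Finsupp.single p 1 + c :=
        (Finsupp.single_le_iff.2 hq').trans le_add_self
      set c' := Finsupp.single p 1 + c - Finsupp.single q 1 with hc'
      have hadd : c' + Finsupp.single q 1 = Finsupp.single p 1 + c := tsub_add_cancel_of_le hle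
      have hc'g : c' ∈ g.support := by
        rw [mem_support_iff]
        intro hz
        rw [hz, add_zero] at h0
        exact mem_support_iff.1 hc.1 h0
      by_cases hbad : ∀ k, monomial (c' + Finsupp.single p k) (1 : K) ∉ I
      · have h1 := hmax c' (Finset.mem_filter.2 ⟨hc'g, hbad⟩)
        have h2 := DFunLike.congr_fun hadd p
        simp [Finsupp.single_eq_of_ne hpq] at h2
        omega
      · push Not at hbad
        obtain ⟨k, hk⟩ := hbad
        refine hc.2 (k + 1) (monomial_mem_of_le (a := c' + Finsupp.single p k) ?_ hk)
        calc c' + Finsupp.single p k ≤ c' + Finsupp.single q 1 + Finsupp.single p k := by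
              gcongr; exact le_self_add
          _ = c + Finsupp.single p (k + 1) := by
              rw [hadd, Finsupp.single_add]; abel
    · rw [add_zero] at h0
      exact mem_support_iff.1 hc.1 h0
  rw [hI.mem_iff]
  intro c hc
  by_contra hcI
  rcases h c hcI with h | h
  · obtain ⟨k, hk⟩ := key p q hpq hg c hc
    exact h k hk
  · obtain ⟨k, hk⟩ := key q p hpq.symm (by rwa [add_comm]) c hc
    exact h k hk

theorem one_le_polyDepth (hI : I ≤ Ideal.span (Set.range X)) {f : MvPolynomial (Fin n) K}
    (hf : f ∈ Ideal.span (Set.range (X : Fin n → MvPolynomial (Fin n) K)))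
    (h : ∀ g, f * g ∈ I → g ∈ I) : 1 ≤ polyDepth K n (MvPolynomial (Fin n) K ⧸ I) := by
  have hone : (1 : MvPolynomial (Fin n) K) ∉ Ideal.span (Set.range X) := by
    intro h1
    have : Ideal.span (Set.range (X : Fin n → MvPolynomial (Fin n) K)) ≤
        RingHom.ker (constantCoeff (R := K)) := by
      rw [Ideal.span_le]
      rintro _ ⟨i, rfl⟩
      simp [RingHom.mem_ker]
    simpa [RingHom.mem_ker] using this h1
  have hreg : RingTheory.Sequence.IsRegular (MvPolynomial (Fin n) K ⧸ I) [f] := by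
    refine ⟨(RingTheory.Sequence.isWeaklyRegular_singleton_iff _ _).2 ?_, ?_⟩
    · rw [isSMulRegular_quotient_iff_mem_of_smul_mem]
      exact fun g hg => h g hg
    · intro htop
      rw [Ideal.ofList_singleton, Submodule.ideal_span_singleton_smul] at htop
      have h1 : Ideal.Quotient.mk I 1 ∈
          (f • ⊤ : Submodule (MvPolynomial (Fin n) K) (MvPolynomial (Fin n) K ⧸ I)) := by
        rw [← htop]; trivial
      obtain ⟨x, -, hx⟩ := (Submodule.mem_smul_pointwise_iff_exists _ _ _).1 h1
      obtain ⟨y, rfl⟩ := Ideal.Quotient.mk_surjective x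
      have hx' : f * y - 1 ∈ I := Ideal.Quotient.eq.1 hx
      refine hone ?_
      have := Ideal.sub_mem _ (Ideal.mul_mem_right y _ hf) (hI hx')
      rwa [sub_sub_cancel] at this
  exact le_iSup_of_le (⟨[f], by simpa using hf, hreg⟩) (by simp)

end Depth

/-! ### A Stanley decomposition in which every summand has a free variable. -/

/-- If membership in the monomial ideal `I` only depends on the exponents truncated at `N`, and
every monomial outside `I` stays outside `I` in some direction, then `S/I` has positive Stanley
depth. -/
theorem one_le_stanleyDepth {K : Type*} [Field K] {n : ℕ} {I : Ideal (MvPolynomial (Fin n) K)}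
    (hI : IsMonomialIdeal I) (N : ℕ)
    (htrunc : ∀ c d : Fin n →₀ ℕ, (∀ v, min (c v) N = min (d v) N) →
      monomial c (1 : K) ∈ I → monomial d (1 : K) ∈ I)
    (hdir : ∀ c : Fin n →₀ ℕ, monomial c (1 : K) ∉ I →
      ∃ r, ∀ k, monomial (c + Finsupp.single r k) (1 : K) ∉ I) :
    1 ≤ stanleyDepth I := by
  classical
  -- `Sat r c`: some multiple of `x^c` by a power of `x_r` is in `I`
  let Sat : Fin n → (Fin n →₀ ℕ) → Prop := fun r c =>
    ∃ k, monomial (c + Finsupp.single r k) (1 : K) ∈ I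
  have hSat_le : ∀ r (c d : Fin n →₀ ℕ), c ≤ d → Sat r c → Sat r d := fun r c d hcd ⟨k, hk⟩ =>
    ⟨k, monomial_mem_of_le (add_le_add_left hcd _) hk⟩
  have hSat_trunc : ∀ r (c d : Fin n →₀ ℕ), (∀ v, min (c v) N = min (d v) N) →
      Sat r c → Sat r d := by
    rintro r c d hcd ⟨k, hk⟩
    refine ⟨k, htrunc _ _ (fun v => ?_) hk⟩
    have := hcd v
    simp only [Finsupp.add_apply]
    omega
  -- `Q r c`: `x^c` is outside `I`, and `r` is the first direction in which it stays outside `I`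
  let Q : Fin n → (Fin n →₀ ℕ) → Prop := fun r c => ¬ Sat r c ∧ ∀ r' < r, Sat r' c
  have hQ_uniq : ∀ r r' c, Q r c → Q r' c → r = r' := by
    intro r r' c h h'
    rcases lt_trichotomy r r' with hlt | heq | hlt
    · exact absurd (h'.2 r hlt) h.1
    · exact heq
    · exact absurd (h.2 r' hlt) h'.1
  have hQ_trunc : ∀ r (c d : Fin n →₀ ℕ), (∀ v, min (c v) N = min (d v) N) → Q r c → Q r d :=
    fun r c d hcd h => ⟨fun hd => h.1 (hSat_trunc r d c (fun v => (hcd v).symm) hd),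
      fun r' hr' => hSat_trunc r' c d hcd (h.2 r' hr')⟩
  have hQ_notMem : ∀ r c, Q r c → monomial c (1 : K) ∉ I := fun r c h hc =>
    h.1 ⟨0, by simpa using hc⟩
  have hQ_exists : ∀ c, monomial c (1 : K) ∉ I → ∃ r, Q r c := by
    intro c hc
    obtain ⟨r, hr⟩ := hdir c hc
    have hne : (Finset.univ.filter fun r => ¬ Sat r c).Nonempty :=
      ⟨r, Finset.mem_filter.2 ⟨Finset.mem_univ _, fun ⟨k, hk⟩ => hr k hk⟩⟩
    refine ⟨_, (Finset.mem_filter.1 (Finset.min'_mem _ hne)).2, fun r' hr' => ?_⟩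
    by_contra h
    exact absurd (Finset.min'_le _ r' (Finset.mem_filter.2 ⟨Finset.mem_univ _, h⟩)) (not_le.2 hr')
  -- With the other exponents fixed, the r-th exponents at which `Q r` holds form an upward ray;
  -- `low` below is its end.
  have hQ_up : ∀ r (c : Fin n →₀ ℕ) i j, i ≤ j → Q r (c.update r i) → Q r (c.update r j) := by
    intro r c i j hij h
    have hle : c.update r i ≤ c.update r j := by
      intro v
      simp only [Finsupp.coe_update, Function.update_apply]
      split_ifs <;> omega
    refine ⟨fun ⟨k, hk⟩ => h.1 ⟨j - i + k, ?_⟩, fun r' hr' => hSat_le r' _ _ hle (h.2 r' hr')⟩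
    convert hk using 3
    ext v
    simp only [Finsupp.add_apply, Finsupp.coe_update, Function.update_apply,
      Finsupp.single_apply]
    split_ifs <;> omega
  -- the cones are indexed by a direction `r` and a truncated exponent `b`
  let ι : Type := {p : Fin n × (Fin n → Fin (N + 1)) //
    (p.2 p.1).val = N ∧ ∃ k,
      Q p.1 ((Finsupp.equivFunOnFinite.symm fun v => (p.2 v).val).update p.1 k)}
  let low : ι → ℕ := fun p => Nat.find p.2.2
  let base : ι → Fin n →₀ ℕ := fun p => Finsupp.equivFunOnFinite.symm fun v => (p.1.2 v).val
  let a : ι → Fin n →₀ ℕ := fun p => (base p).update p.1.1 (low p)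
  -- Exponents beyond N are invisible to I, so the coordinates equal to N are free. The entry N at
  -- the direction r itself is a convention: it puts r into Z and makes the index unique, while the
  -- cone starts at `low p` there.
  let Z : ι → Finset (Fin n) := fun p => Finset.univ.filter fun v => (p.1.2 v).val = N
  -- Each cone is the class of the monomials with a given first direction r and given truncated
  -- exponents away from r, so the cones partition the complement of I.
  have hcone : ∀ p c, (a p ≤ c ∧ ∀ v ∉ Z p, c v = a p v) ↔
      (Q p.1.1 c ∧ ∀ v ≠ p.1.1, min (c v) N = (p.1.2 v).val) := by
    intro p c
    have hbase : ∀ v, base p v = (p.1.2 v).val := fun v => rfl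
    have ha : ∀ v, a p v = if v = p.1.1 then low p else (p.1.2 v).val := by
      intro v
      simp only [a, Finsupp.coe_update, Function.update_apply, hbase]
    have hZ : ∀ v, v ∉ Z p ↔ (p.1.2 v).val ≠ N := by
      intro v; simp [Z]
    have hlow : ∀ k, Q p.1.1 ((base p).update p.1.1 k) ↔ low p ≤ k := fun k =>
      ⟨fun h => Nat.find_min' p.2.2 h, fun h => hQ_up _ _ _ _ h (Nat.find_spec p.2.2)⟩
    have hQc : (∀ v ≠ p.1.1, min (c v) N = (p.1.2 v).val) →
        (Q p.1.1 c ↔ low p ≤ c p.1.1) := by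
      intro h
      rw [← hlow]
      have hmin : ∀ v, min (c v) N = min ((base p).update p.1.1 (c p.1.1) v) N := by
        intro v
        simp only [Finsupp.coe_update, Function.update_apply, hbase]
        split_ifs with hv
        · rw [hv]
        · rw [← h v hv]; omega
      exact ⟨hQ_trunc _ _ _ hmin, hQ_trunc _ _ _ fun v => (hmin v).symm⟩
    constructor
    · rintro ⟨hac, hcZ⟩
      have hoff : ∀ v ≠ p.1.1, min (c v) N = (p.1.2 v).val := by
        intro v hv
        have h1 := hac v
        have h2 := hcZ v
        rw [ha, if_neg hv] at h1 h2
        rw [hZ] at h2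
        have := (p.1.2 v).isLt
        omega
      refine ⟨(hQc hoff).2 ?_, hoff⟩
      have := hac p.1.1
      rwa [ha, if_pos rfl] at this
    · rintro ⟨hQ, hoff⟩
      have hl := (hQc hoff).1 hQ
      refine ⟨fun v => ?_, fun v hv => ?_⟩
      · rw [ha]
        split_ifs with hv
        · rwa [hv]
        · have := hoff v hv
          omega
      · rw [hZ] at hv
        have hvp : v ≠ p.1.1 := by
          rintro rfl
          exact hv p.2.1
        rw [ha, if_neg hvp]
        have := hoff v hvp
        omega
  obtain ⟨D, hD⟩ := exists_stanleyDecomposition hI a Z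
    (fun p c h => hQ_notMem _ _ ((hcone p c).1 h).1)
    (by
      intro c hc
      obtain ⟨r, hr⟩ := hQ_exists c hc
      let b : Fin n → Fin (N + 1) := fun v =>
        if v = r then ⟨N, N.lt_succ_self⟩ else ⟨min (c v) N, by omega⟩
      have hb : ∀ v, (b v).val = if v = r then N else min (c v) N := by
        intro v; simp only [b]; split_ifs <;> rfl
      refine ⟨⟨(r, b), by simp [hb], c r, ?_⟩, (hcone _ c).2 ⟨hr, fun v hv => ?_⟩⟩
      · refine hQ_trunc r c _ (fun v => ?_) hr
        simp only [Finsupp.coe_update, Function.update_apply,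
          Finsupp.equivFunOnFinite_symm_apply_apply, hb]
        split_ifs with hv
        · rw [hv]
        · omega
      · simp [hb, hv])
    (by
      intro p q c hp hq
      obtain ⟨hp1, hp2⟩ := (hcone p c).1 hp
      obtain ⟨hq1, hq2⟩ := (hcone q c).1 hq
      have hr := hQ_uniq _ _ _ hp1 hq1
      refine Subtype.ext (Prod.ext hr (funext fun v => Fin.ext ?_))
      by_cases hv : v = p.1.1
      · rw [hv, p.2.1, hr, q.2.1]
      · rw [← hp2 v hv, hq2 v (hr ▸ hv)])
  refine le_iSup_of_le D (le_iInf fun i => ?_)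
  obtain ⟨p, hp⟩ := hD i
  rw [hp, Nat.one_le_cast, Finset.one_le_card]
  exact ⟨p.1.1, by simp [Z, p.2.1]⟩

/-! ### Membership in powers of path ideals as a covering problem. -/

section CycleIdeal

variable {K : Type*} [Field K]

theorem span_range_monomial_pow {σ ι : Type*} [Fintype ι] (g : ι → σ →₀ ℕ) (t : ℕ) :
    Ideal.span (Set.range fun i => monomial (g i) (1 : K)) ^ t =
      Ideal.span ((fun a => monomial a (1 : K)) ''
        {c | ∃ y : ι → ℕ, ∑ i, y i = t ∧ c = ∑ i, y i • g i}) := by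
  classical
  induction t with
  | zero =>
    rw [pow_zero, eq_comm, Ideal.one_eq_top, Ideal.eq_top_iff_one]
    exact Ideal.subset_span ⟨0, ⟨0, by simp, by simp⟩, rfl⟩
  | succ t ih =>
    rw [pow_succ, ih, Ideal.span_mul_span']
    congr 1
    ext f
    rw [Set.mem_mul]
    constructor
    · rintro ⟨_, ⟨_, ⟨y, hy, rfl⟩, rfl⟩, _, ⟨i, rfl⟩, rfl⟩
      refine ⟨_, ⟨y + Pi.single i 1, ?_, rfl⟩, ?_⟩
      · simp [Finset.sum_add_distrib, hy]
      · simp [monomial_mul, add_smul, Finset.sum_add_distrib, Pi.single_apply, ite_smul]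
    · rintro ⟨_, ⟨y, hy, rfl⟩, rfl⟩
      obtain ⟨i, -, hi⟩ : ∃ i ∈ Finset.univ, y i ≠ 0 :=
        Finset.exists_ne_zero_of_sum_ne_zero (by rw [hy]; omega)
      obtain ⟨z, rfl⟩ : ∃ z : ι → ℕ, y = z + Pi.single i 1 := by
        refine ⟨y - Pi.single i 1, funext fun j => ?_⟩
        simp only [Pi.add_apply, Pi.sub_apply, Pi.single_apply]
        split_ifs with h
        · subst h; omega
        · omega
      refine ⟨_, ⟨_, ⟨z, ?_, rfl⟩, rfl⟩, _, ⟨i, rfl⟩, ?_⟩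
      · simpa [Finset.sum_add_distrib] using hy
      · simp [monomial_mul, add_smul, Finset.sum_add_distrib, Pi.single_apply, ite_smul]

/-- The exponent vector of the generator of the `m`-path ideal of the `n`-cycle that starts at the
vertex `i`. -/
noncomputable def pathExponent (n m : ℕ) (i : Fin n) : Fin n →₀ ℕ :=
  ∑ k ∈ Finset.range m, Finsupp.single (⟨(i.val + k) % n, Nat.mod_lt _ i.pos⟩ : Fin n) 1

theorem cyclePathIdeal_pow_eq (n m t : ℕ) :
    cyclePathIdeal K n m ^ t = Ideal.span ((fun a => monomial a (1 : K)) ''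
        {c | ∃ y : Fin n → ℕ, ∑ i, y i = t ∧ c = ∑ i, y i • pathExponent n m i}) := by
  rw [← span_range_monomial_pow, cyclePathIdeal]
  congr 3
  ext1 i
  rw [pathExponent, monomial_sum_one]
  rfl

theorem isMonomialIdeal_cyclePathIdeal_pow (n m t : ℕ) :
    IsMonomialIdeal (cyclePathIdeal K n m ^ t) := by
  rw [cyclePathIdeal_pow_eq]
  exact isMonomialIdeal_span _

theorem pathExponent_self_apply (n : ℕ) (i v : Fin n) : pathExponent n n i v = 1 := by
  rw [pathExponent, Finsupp.finsetSum_apply]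
  have hn := i.pos
  rw [Finset.sum_eq_single_of_mem ((v.val + (n - i.val)) % n)
    (Finset.mem_range.2 (Nat.mod_lt _ hn))]
  · rw [Finsupp.single_apply, if_pos]
    refine Fin.ext ?_
    simp only [Nat.add_mod_mod]
    rw [show i.val + (v.val + (n - i.val)) = v.val + n by omega, Nat.add_mod_right,
      Nat.mod_eq_of_lt v.isLt]
  · intro k hk hne
    rw [Finset.mem_range] at hk
    rw [Finsupp.single_apply, if_neg]
    rintro rfl
    refine hne ?_
    simp only [Nat.mod_add_mod]
    rw [show i.val + k + (n - i.val) = k + n by omega, Nat.add_mod_right, Nat.mod_eq_of_lt hk]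

theorem monomial_mem_cyclePathIdeal_pow_iff (n m t : ℕ) (c : Fin n →₀ ℕ) :
    monomial c (1 : K) ∈ cyclePathIdeal K n m ^ t ↔
      ∃ y : Fin n → ℕ, ∑ i, y i = t ∧ ∀ v, ∑ i, y i * pathExponent n m i v ≤ c v := by
  rw [cyclePathIdeal_pow_eq, monomial_mem_span_iff]
  constructor
  · rintro ⟨_, ⟨y, hy, rfl⟩, hle⟩
    refine ⟨y, hy, fun v => ?_⟩
    simpa [Finsupp.finsetSum_apply] using hle v
  · rintro ⟨y, hy, h⟩
    refine ⟨_, ⟨y, hy, rfl⟩, fun v => ?_⟩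
    simpa [Finsupp.finsetSum_apply] using h v

/-- A path of m + 1 vertices runs once round the cycle; dropping its last vertex i - 1 leaves the
generator. -/
theorem pathExponent_pred_apply (m : ℕ) (i v : Fin (m + 1)) :
    pathExponent (m + 1) m i v + (if i = v + 1 then 1 else 0) = 1 := by
  refine Eq.trans ?_ (pathExponent_self_apply (m + 1) i v)
  conv_rhs => rw [pathExponent, Finset.sum_range_succ, Finsupp.add_apply, Finsupp.single_apply]
  congr 1
  refine if_congr ?_ rfl rfl
  have : (⟨(i.val + m) % (m + 1), Nat.mod_lt _ i.pos⟩ : Fin (m + 1)) = i - 1 := by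
    refine eq_sub_of_add_eq (Fin.ext ?_)
    rw [Fin.val_add]
    simp [add_assoc, Nat.mod_eq_of_lt i.isLt]
  rw [this, sub_eq_iff_eq_add]

theorem pathExponent_pred_pred_apply (m : ℕ) (i v : Fin (m + 2)) :
    pathExponent (m + 2) m i v + (if i = v + 1 + 1 then 1 else 0) +
      (if i = v + 1 then 1 else 0) = 1 := by
  refine Eq.trans ?_ (pathExponent_pred_apply (m + 1) i v)
  conv_rhs => rw [pathExponent, Finset.sum_range_succ, Finsupp.add_apply, Finsupp.single_apply]
  congr 2
  refine if_congr ?_ rfl rfl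
  have : (⟨(i.val + m) % (m + 2), Nat.mod_lt _ i.pos⟩ : Fin (m + 2)) = i - 1 - 1 := by
    refine eq_sub_of_add_eq (eq_sub_of_add_eq (Fin.ext ?_))
    rw [Fin.val_add, Fin.val_add]
    simp [add_assoc, Nat.mod_eq_of_lt i.isLt]
  rw [this, sub_eq_iff_eq_add, sub_eq_iff_eq_add]

theorem monomial_mem_pow_pred_iff (m t : ℕ) (c : Fin (m + 1) →₀ ℕ) :
    monomial c (1 : K) ∈ cyclePathIdeal K (m + 1) m ^ t ↔
      ∃ y : Fin (m + 1) → ℕ, ∑ i, y i = t ∧ ∀ v, t ≤ c v + y v := by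
  rw [monomial_mem_cyclePathIdeal_pow_iff]
  have key : ∀ (y : Fin (m + 1) → ℕ) v,
      ∑ i, y i * pathExponent (m + 1) m i v + y (v + 1) = ∑ i, y i := by
    intro y v
    calc _ = ∑ i, y i * (pathExponent (m + 1) m i v + if i = v + 1 then 1 else 0) := by
          simp [mul_add, Finset.sum_add_distrib]
      _ = _ := by simp only [pathExponent_pred_apply, mul_one]
  constructor
  · rintro ⟨y, hy, h⟩
    -- The generator omitting v starts at v + 1; the shift indexes multiplicities by the omitted
    -- vertex.
    refine ⟨fun v => y (v + 1), ?_, fun v => ?_⟩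
    · rw [← hy]; exact Equiv.sum_comp (Equiv.addRight 1) y
    · have := key y v; have := h v; dsimp only; omega
  · rintro ⟨y, hy, h⟩
    have hs : ∑ v, y (v - 1) = t := by rw [← hy]; exact Equiv.sum_comp (Equiv.subRight 1) y
    refine ⟨fun v => y (v - 1), hs, fun v => ?_⟩
    have h1 := key (fun v => y (v - 1)) v
    have := h v
    rw [hs] at h1
    simp only [add_sub_cancel_right] at h1 ⊢
    omega

theorem monomial_mem_pow_pred_pred_iff (m t : ℕ) (c : Fin (m + 2) →₀ ℕ) :
    monomial c (1 : K) ∈ cyclePathIdeal K (m + 2) m ^ t ↔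
      ∃ y : Fin (m + 2) → ℕ, ∑ i, y i = t ∧ ∀ v, t ≤ c v + y v + y (v - 1) := by
  rw [monomial_mem_cyclePathIdeal_pow_iff]
  have key : ∀ (y : Fin (m + 2) → ℕ) v,
      ∑ i, y i * pathExponent (m + 2) m i v + y (v + 1 + 1) + y (v + 1) = ∑ i, y i := by
    intro y v
    calc _ = ∑ i, y i * (pathExponent (m + 2) m i v + (if i = v + 1 + 1 then 1 else 0) +
            if i = v + 1 then 1 else 0) := by
          simp [mul_add, Finset.sum_add_distrib]
      _ = _ := by simp only [pathExponent_pred_pred_apply, mul_one]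
  constructor
  · rintro ⟨y, hy, h⟩
    -- The generator starting at v + 2 omits v and v + 1. After the shift `y v` is the weight of the
    -- edge {v, v + 1}, so v is covered by `y v` and `y (v - 1)`.
    refine ⟨fun v => y (v + 1 + 1), ?_, fun v => ?_⟩
    · rw [← hy]; exact Equiv.sum_comp ((Equiv.addRight 1).trans (Equiv.addRight 1)) y
    · have := key y v; have := h v; simp only [sub_add_cancel]; omega
  · rintro ⟨y, hy, h⟩
    have hs : ∑ v, y (v - 1 - 1) = t := by
      rw [← hy]; exact Equiv.sum_comp ((Equiv.subRight 1).trans (Equiv.subRight 1)) y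
    refine ⟨fun v => y (v - 1 - 1), hs, fun v => ?_⟩
    have h1 := key (fun v => y (v - 1 - 1)) v
    have := h v
    rw [hs] at h1
    simp only [add_sub_cancel_right] at h1 ⊢
    omega

theorem cyclePathIdeal_le_span_X {n m : ℕ} (hm : m ≠ 0) :
    cyclePathIdeal K n m ≤ Ideal.span (Set.range X) := by
  rw [cyclePathIdeal, Ideal.span_le]
  rintro _ ⟨i, rfl⟩
  obtain ⟨k, rfl⟩ := Nat.exists_eq_succ_of_ne_zero hm
  dsimp only
  rw [Finset.prod_range_succ]
  exact Ideal.mul_mem_left _ _ (Ideal.subset_span ⟨_, rfl⟩)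

end CycleIdeal

/-! ### Weighted edge covers of bipartite graphs, from Hall's theorem. -/

/-- Egerváry's theorem for weighted edge covers: in a bipartite multigraph with edges `E`, ends
`s : E → α` and `r : E → β`, and demands `d`, `d'`, there is an integral weighting of the edges of
total at most `t` that meets every demand, as soon as no independent set of vertices has a total
demand above `t`. -/
theorem exists_weighted_edge_cover {α β E : Type*} [Fintype α] [Fintype β] [Fintype E]
    [DecidableEq α] [DecidableEq β] [DecidableEq E] (s : E → α) (r : E → β) (d : α → ℕ) (d' : β → ℕ)
    (t : ℕ) (hs : ∀ a, d a ≠ 0 → ∃ e, s e = a) (hr : ∀ b, d' b ≠ 0 → ∃ e, r e = b)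
    (h : ∀ X : Finset α, ∑ a ∈ X, d a +
      ∑ b ∈ ((Finset.univ.filter fun e => s e ∈ X).image r)ᶜ, d' b ≤ t) :
    ∃ y : E → ℕ, ∑ e, y e ≤ t ∧ (∀ a, d a ≤ ∑ e with s e = a, y e) ∧
      ∀ b, d' b ≤ ∑ e with r e = b, y e := by
  classical
  let ι := Σ a, Fin (d a)
  let κ := Σ b, Fin (d' b)
  have hκ : Fintype.card κ = ∑ b, d' b := by simp [κ]
  have hD : ∑ b, d' b ≤ t := by simpa using h ∅
  have hcardι : ∀ a, (Finset.univ.filter fun p : ι => p.1 = a).card = d a := by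
    intro a
    have : (Finset.univ.filter fun p : ι => p.1 = a) =
        ({a} : Finset α).sigma fun a => (Finset.univ : Finset (Fin (d a))) := by
      ext p; rw [Finset.mem_sigma]; simp
    rw [this, Finset.card_sigma]; simp
  have hcardκ : ∀ B : Finset β, (Finset.univ.filter fun q : κ => q.1 ∈ B).card = ∑ b ∈ B, d' b := by
    intro B
    have : (Finset.univ.filter fun q : κ => q.1 ∈ B) =
        B.sigma fun b => (Finset.univ : Finset (Fin (d' b))) := by
      ext p; rw [Finset.mem_sigma]; simp
    rw [this, Finset.card_sigma]; simp
  -- Each unit of demand in α is to be matched with a unit of demand at an adjacent vertex of β, so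
  -- that one edge serves both, or with one of t - ∑ d' spare slots. Hall's condition for a set of
  -- units is `h` for the set X of their vertices.
  let T : ι → Finset (κ ⊕ Fin (t - ∑ b, d' b)) := fun p =>
    (Finset.univ.filter fun q : κ => ∃ e, s e = p.1 ∧ r e = q.1).disjSum Finset.univ
  have hall : ∀ S : Finset ι, S.card ≤ (S.biUnion T).card := by
    intro S
    rcases S.eq_empty_or_nonempty with rfl | ⟨p₀, hp₀⟩
    · simp
    let X := S.image Sigma.fst
    let NX := (Finset.univ.filter fun e => s e ∈ X).image r
    have h1 : S.card ≤ ∑ a ∈ X, d a := by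
      have hsub : S ⊆ X.sigma fun a => (Finset.univ : Finset (Fin (d a))) := by
        intro p hp
        rw [Finset.mem_sigma]
        exact ⟨Finset.mem_image_of_mem _ hp, Finset.mem_univ _⟩
      have := Finset.card_le_card hsub
      rw [Finset.card_sigma] at this
      simpa using this
    have h2 : (Finset.univ.filter fun q : κ => q.1 ∈ NX).disjSum Finset.univ ⊆ S.biUnion T := by
      rintro (q | j) hq
      · rw [Finset.inl_mem_disjSum, Finset.mem_filter, Finset.mem_image] at hq
        obtain ⟨-, e, he, heq⟩ := hq
        obtain ⟨p, hp, hpe⟩ := Finset.mem_image.1 (Finset.mem_filter.1 he).2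
        refine Finset.mem_biUnion.2 ⟨p, hp, ?_⟩
        rw [Finset.inl_mem_disjSum, Finset.mem_filter]
        exact ⟨Finset.mem_univ _, e, hpe.symm, heq⟩
      · exact Finset.mem_biUnion.2 ⟨p₀, hp₀, Finset.inr_mem_disjSum.2 (Finset.mem_univ _)⟩
    have h3 := Finset.card_le_card h2
    rw [Finset.card_disjSum, hcardκ, Finset.card_univ, Fintype.card_fin] at h3
    have h4 := Finset.sum_add_sum_compl NX d'
    have h5 := h X
    change _ + ∑ b ∈ NXᶜ, d' b ≤ t at h5
    omega
  obtain ⟨F, hFinj, hF⟩ := (Finset.all_card_le_biUnion_card_iff_exists_injective T).1 hall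
  have hε : ∀ p : ι, ∃ e, s e = p.1 ∧ ∀ q, F p = Sum.inl q → r e = q.1 := by
    intro p
    have hp := hF p
    rcases hFp : F p with q | j
    · rw [hFp, Finset.inl_mem_disjSum, Finset.mem_filter] at hp
      obtain ⟨-, e, he, heq⟩ := hp
      exact ⟨e, he, fun q' hq' => by rw [heq, Sum.inl_injective hq']⟩
    · obtain ⟨e, he⟩ := hs p.1 (by have := p.2.isLt; omega)
      exact ⟨e, he, fun q hq => by simp at hq⟩
  have hε' : ∀ q : κ, ∃ e, r e = q.1 := fun q => hr q.1 (by have := q.2.isLt; omega)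
  choose ε hεs hεr using hε
  choose ε' hε'r using hε'
  -- The unmatched units of β each get an edge of their own. The total weight is |ι| + |U|, which is
  -- at most t because F injects ι into the complement of U together with the spare slots.
  let U : Finset κ := Finset.univ.filter fun q => ∀ p, F p ≠ Sum.inl q
  let y : E → ℕ := fun e =>
    (Finset.univ.filter fun p => ε p = e).card + (U.filter fun q => ε' q = e).card
  have hsum : ∀ P : E → Prop, [DecidablePred P] → ∑ e with P e, y e =
      (Finset.univ.filter fun p => P (ε p)).card + (U.filter fun q => P (ε' q)).card := by
    intro P _
    rw [Finset.sum_add_distrib]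
    congr 1
    · rw [Finset.card_eq_sum_card_fiberwise (f := ε) (t := Finset.univ.filter P)
        (fun p hp => by simpa using hp)]
      refine Finset.sum_congr rfl fun e he => ?_
      congr 1
      ext p
      have := (Finset.mem_filter.1 he).2
      simp only [Finset.mem_filter, Finset.mem_univ, true_and]
      exact ⟨fun hp => ⟨hp ▸ this, hp⟩, fun hp => hp.2⟩
    · rw [Finset.card_eq_sum_card_fiberwise (f := ε') (t := Finset.univ.filter P)
        (fun p hp => by simpa using (Finset.mem_filter.1 hp).2)]
      refine Finset.sum_congr rfl fun e he => ?_
      congr 1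
      ext p
      have := (Finset.mem_filter.1 he).2
      simp only [Finset.mem_filter]
      exact ⟨fun hp => ⟨⟨hp.1, hp.2 ▸ this⟩, hp.2⟩, fun hp => ⟨hp.1.1, hp.2⟩⟩
  refine ⟨y, ?_, fun a => ?_, fun b => ?_⟩
  · have h1 := hsum fun _ => True
    simp only [Finset.filter_true, Finset.card_univ] at h1
    rw [h1]
    have h2 : Finset.univ.image F ⊆ Uᶜ.disjSum Finset.univ := by
      intro x hx
      obtain ⟨p, -, rfl⟩ := Finset.mem_image.1 hx
      rcases hFp : F p with q | j
      · rw [Finset.inl_mem_disjSum, Finset.mem_compl, Finset.mem_filter]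
        exact fun hq => hq.2 p hFp
      · exact Finset.inr_mem_disjSum.2 (Finset.mem_univ _)
    have h3 := Finset.card_le_card h2
    rw [Finset.card_image_of_injective _ hFinj, Finset.card_disjSum, Finset.card_univ,
      Finset.card_univ, Fintype.card_fin] at h3
    have h4 := Finset.card_add_card_compl U
    omega
  · rw [hsum, ← hcardι a]
    refine (Finset.card_le_card fun p hp => ?_).trans (Nat.le_add_right _ _)
    simp only [Finset.mem_filter, Finset.mem_univ, true_and] at hp ⊢
    rw [hεs, hp]
  · rw [hsum]
    have h1 : d' b = (Finset.univ.filter fun q : κ => q.1 = b).card := by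
      have := hcardκ {b}
      simpa using this.symm
    rw [h1, ← Finset.card_filter_add_card_filter_not (fun q => q ∈ U), add_comm]
    refine add_le_add ?_ (Finset.card_le_card fun q hq => ?_)
    · have hmatch : ∀ q : κ, q ∉ U → ∃ p, F p = Sum.inl q := by
        intro q hq
        simpa [U] using hq
      refine (Finset.card_le_card_of_injOn Sum.inl (fun q hq => ?_)
        Sum.inl_injective.injOn).trans (Finset.card_image_le (f := F))
      simp only [Finset.coe_filter, Finset.mem_filter, Finset.mem_univ, true_and,
        Set.mem_ofPred_eq] at hq
      obtain ⟨p, hp⟩ := hmatch q hq.2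
      rw [Finset.mem_coe, Finset.mem_image]
      exact ⟨p, by simp [hεr p q hp, hq.1], hp⟩
    · simp only [Finset.mem_filter, Finset.mem_univ, true_and] at hq ⊢
      exact ⟨hq.2, by rw [hε'r, hq.1]⟩

/-! ### Edge covers and matchings of a cycle. -/

section Cycle

variable {m : ℕ}

theorem sum_add_sum_sub_one (y : Fin (m + 2) → ℕ) : ∑ v, (y v + y (v - 1)) = 2 * ∑ v, y v := by
  have : ∑ v, y (v - 1) = ∑ v, y v := Equiv.sum_comp (Equiv.subRight 1) y
  rw [Finset.sum_add_distrib, this, two_mul]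

/-- An edge has at most one end in an independent set, so no weight is counted twice. -/
theorem sum_independent_le (y : Fin (m + 2) → ℕ) {T : Finset (Fin (m + 2))}
    (hT : ∀ v ∈ T, v + 1 ∉ T) : ∑ v ∈ T, (y v + y (v - 1)) ≤ ∑ v, y v := by
  classical
  have h1 : ∑ v ∈ T, y (v - 1) = ∑ v ∈ T.image (· - 1), y v :=
    (Finset.sum_image fun a _ b _ hab => sub_left_injective hab).symm
  have h2 : Disjoint T (T.image (· - 1)) := by
    rw [Finset.disjoint_right]
    intro v hv hvT
    obtain ⟨w, hw, rfl⟩ := Finset.mem_image.1 hv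
    exact hT _ hvT (by rwa [sub_add_cancel])
  rw [Finset.sum_add_distrib, h1, ← Finset.sum_union h2]
  exact Finset.sum_le_sum_of_subset (Finset.subset_univ _)

theorem even_val_add_one_iff (hm : Even m) (v : Fin (m + 2)) :
    Even (v + 1).val ↔ ¬ Even v.val := by
  rw [Fin.val_add_one]
  split_ifs with h
  · subst h
    simp [Nat.even_add_one, hm]
  · rw [Nat.even_add_one]

/-- On an even cycle, independent sets are the only obstruction to weighted edge covers. -/
theorem exists_cycle_edge_cover (hm : Even m) (d : Fin (m + 2) → ℕ) (t : ℕ)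
    (h : ∀ T : Finset (Fin (m + 2)), (∀ v ∈ T, v + 1 ∉ T) → ∑ v ∈ T, d v ≤ t) :
    ∃ y : Fin (m + 2) → ℕ, ∑ v, y v = t ∧ ∀ v, d v ≤ y v + y (v - 1) := by
  classical
  have hpar := even_val_add_one_iff hm
  obtain ⟨y, hy, hys, hyr⟩ := exists_weighted_edge_cover
    (fun e : Fin (m + 2) => if Even e.val then e else e + 1)
    (fun e : Fin (m + 2) => if Even e.val then e + 1 else e)
    (fun v => if Even v.val then d v else 0) (fun v => if Even v.val then 0 else d v) t
    (by
      intro a ha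
      have : Even a.val := by by_contra hn; simp [hn] at ha
      exact ⟨a, if_pos this⟩)
    (by
      intro b hb
      have : ¬ Even b.val := fun hn => by simp [hn] at hb
      exact ⟨b, if_neg this⟩)
    (by
      intro X
      have hflip : ∀ s : Finset (Fin (m + 2)), ∑ v ∈ s, (if Even v.val then 0 else d v) =
          ∑ v ∈ s.filter (fun v => ¬ Even v.val), d v := by
        intro s
        rw [Finset.sum_filter]
        exact Finset.sum_congr rfl fun v _ => by split_ifs <;> simp_all
      -- The even vertices of X and the odd vertices not adjacent to them form an independent set.
      rw [← Finset.sum_filter, hflip, ← Finset.sum_union]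
      · refine h _ fun v hv hv' => ?_
        simp only [Finset.mem_union, Finset.mem_filter, Finset.mem_compl, Finset.mem_image,
          Finset.mem_univ, true_and, not_exists, not_and, hpar] at hv hv'
        rcases hv with ⟨hvX, hve⟩ | ⟨hvN, hvo⟩
        · rcases hv' with ⟨-, h1⟩ | ⟨h1, -⟩
          · exact h1 hve
          · exact h1 v (by rwa [if_pos hve]) (by rw [if_pos hve])
        · rcases hv' with ⟨h1, -⟩ | ⟨-, h1⟩
          · exact hvN v (by rwa [if_neg hvo]) (by rw [if_neg hvo])
          · exact h1 hvo
      · rw [Finset.disjoint_left]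
        intro v hv hv'
        exact (Finset.mem_filter.1 hv').2 (Finset.mem_filter.1 hv).2)
  have hpair : ∀ (s : Finset (Fin (m + 2))) (v : Fin (m + 2)), s ⊆ {v, v - 1} →
      ∑ e ∈ s, y e ≤ y v + y (v - 1) := by
    intro s v hs
    have hne : v ≠ v - 1 := by
      intro hv
      have := hpar (v - 1)
      rw [sub_add_cancel, ← hv] at this
      tauto
    rw [← Finset.sum_pair hne]
    exact Finset.sum_le_sum_of_subset hs
  -- Any unused weight goes to one edge, which makes the total exactly t.
  refine ⟨y + Pi.single 0 (t - ∑ v, y v), ?_, fun v => ?_⟩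
  · simp only [Pi.add_apply, Finset.sum_add_distrib, Finset.sum_pi_single', Finset.mem_univ,
      if_true]
    omega
  · have hle : d v ≤ y v + y (v - 1) := by
      by_cases hv : Even v.val
      · have h1 := hys v
        rw [if_pos hv] at h1
        refine h1.trans (hpair _ v fun e he => ?_)
        rw [Finset.mem_filter] at he
        rw [Finset.mem_insert, Finset.mem_singleton, eq_sub_iff_add_eq]
        split_ifs at he
        · exact Or.inl he.2
        · exact Or.inr he.2
      · have h1 := hyr v
        rw [if_neg hv] at h1
        refine h1.trans (hpair _ v fun e he => ?_)
        rw [Finset.mem_filter] at he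
        rw [Finset.mem_insert, Finset.mem_singleton, eq_sub_iff_add_eq]
        split_ifs at he
        · exact Or.inr he.2
        · exact Or.inl he.2
    refine hle.trans ?_
    simp only [Pi.add_apply]
    omega

/-- An odd cycle without one vertex has a perfect matching. -/
theorem exists_matching_of_odd (hm : Odd m) (i : Fin (m + 2)) :
    ∃ y : Fin (m + 2) → ℕ, ∀ v, y v + y (v - 1) + (if v = i then 1 else 0) = 1 := by
  -- At distances from i, the edges are {1, 2}, {3, 4}, …, {m, m + 1}.
  refine ⟨fun v => if (v - i).val % 2 = 1 then 1 else 0, fun v => ?_⟩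
  dsimp only
  rw [sub_right_comm, Fin.coe_sub_one]
  rw [Nat.odd_iff] at hm
  by_cases hv : v = i
  · have h1 : ¬ (m + 1) % 2 = 1 := by omega
    simp [hv, h1]
  · have : (v - i).val ≠ 0 := by rwa [Ne, Fin.val_eq_zero_iff, sub_eq_zero]
    simp only [hv, if_false, sub_eq_zero]
    split_ifs <;> omega

/-- An even cycle without one vertex of each colour class has a perfect matching. -/
theorem exists_matching_of_even (hm : Even m) {i j : Fin (m + 2)} (hi : Even i.val)
    (hj : ¬ Even j.val) : ∃ y : Fin (m + 2) → ℕ, ∀ v,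
      y v + y (v - 1) + (if v = i then 1 else 0) + (if v = j then 1 else 0) = 1 := by
  rw [Nat.even_iff] at hm hi hj
  have hl : (j - i).val % 2 = 1 := by
    rw [Fin.val_sub, Nat.mod_mod_of_dvd _ (by omega)]
    have := i.isLt
    omega
  let l := (j - i).val
  -- Going round from i, the vertices strictly before j are paired as {1, 2}, {3, 4}, … and those
  -- after j as {l + 1, l + 2}, …; both arcs have an even number of vertices since l is odd.
  refine ⟨fun v => if (v - i).val % 2 = 1 ∧ (v - i).val < l ∨ (v - i).val % 2 = 0 ∧ l < (v - i).val
    then 1 else 0, fun v => ?_⟩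
  have hvj : v = j ↔ (v - i).val = l := by
    rw [Fin.val_inj, sub_left_inj]
  have hlt : l < m + 2 := (j - i).isLt
  dsimp only
  rw [sub_right_comm, Fin.coe_sub_one]
  simp only [hvj]
  by_cases hv : v = i
  · have h1 : (m + 1) % 2 = 1 := by omega
    have h2 : ¬ m + 1 < l := by omega
    have h3 : ¬ 0 = l := by omega
    simp [hv, h1, h2, h3]
  · have : (v - i).val ≠ 0 := by rwa [Ne, Fin.val_eq_zero_iff, sub_eq_zero]
    simp only [hv, if_false, sub_eq_zero]
    split_ifs <;> omega

theorem card_even_eq {h : ℕ} (hm : m + 2 = 2 * h) :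
    (Finset.univ.filter fun v : Fin (m + 2) => Even v.val).card = h ∧
      (Finset.univ.filter fun v : Fin (m + 2) => ¬ Even v.val).card = h := by
  have hm' : Even m := by rw [Nat.even_iff]; omega
  have h1 := Finset.card_filter_add_card_filter_not (s := Finset.univ)
    (fun v : Fin (m + 2) => Even v.val)
  have h2 : (Finset.univ.filter fun v : Fin (m + 2) => ¬ Even v.val).card =
      (Finset.univ.filter fun v : Fin (m + 2) => Even v.val).card := by
    refine Finset.card_equiv (Equiv.addRight 1) fun v => ?_
    simp [even_val_add_one_iff hm']
  rw [Finset.card_univ, Fintype.card_fin] at h1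
  omega

/-- The demands t - c_v are 1 everywhere plus s at both ends of the edge {0, 1}: a matching plus
weight s on that edge meets them wherever the matching covers. The bound on s prevents truncated
subtraction. -/
theorem exists_exponent {s t : ℕ} (hst : s + 1 ≤ t) : ∃ c : Fin (m + 2) →₀ ℕ,
    ∀ v, c v + 1 + (if v = 0 then s else 0) + (if v = 1 then s else 0) = t := by
  refine ⟨Finsupp.equivFunOnFinite.symm fun v =>
    t - 1 - (if v = 0 then s else 0) - (if v = 1 then s else 0), fun v => ?_⟩
  rw [Finsupp.equivFunOnFinite_symm_apply_apply]
  have h01 : (0 : Fin (m + 2)) ≠ 1 := zero_ne_one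
  split_ifs <;> omega

end Cycle

/-! ### Depth and Stanley depth of the powers. -/

section CycleDepth

variable {K : Type*} [Field K] {m t : ℕ}

theorem sum_tsub_le_of_mem {c : Fin (m + 2) →₀ ℕ}
    (hc : monomial c (1 : K) ∈ cyclePathIdeal K (m + 2) m ^ t)
    {T : Finset (Fin (m + 2))} (hT : ∀ v ∈ T, v + 1 ∉ T) : ∑ v ∈ T, (t - c v) ≤ t := by
  obtain ⟨y, hy, hyc⟩ := (monomial_mem_pow_pred_pred_iff m t c).1 hc
  refine le_trans (Finset.sum_le_sum fun v _ => ?_) ((sum_independent_le y hT).trans hy.le)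
  have := hyc v
  omega

/-- An independent set T omits 0 or 1. Raising the exponent at an omitted vertex leaves the demands
on T unchanged, so T obstructs neither before nor after. -/
theorem mem_of_mem_saturations (hm : Even m) {c : Fin (m + 2) →₀ ℕ} {k l : ℕ}
    (hk : monomial (c + Finsupp.single 0 k) (1 : K) ∈ cyclePathIdeal K (m + 2) m ^ t)
    (hl : monomial (c + Finsupp.single 1 l) (1 : K) ∈ cyclePathIdeal K (m + 2) m ^ t) :
    monomial c (1 : K) ∈ cyclePathIdeal K (m + 2) m ^ t := by
  have hsum : ∀ (p : Fin (m + 2)) k,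
      monomial (c + Finsupp.single p k) (1 : K) ∈ cyclePathIdeal K (m + 2) m ^ t →
      ∀ T : Finset (Fin (m + 2)), (∀ v ∈ T, v + 1 ∉ T) → p ∉ T → ∑ v ∈ T, (t - c v) ≤ t := by
    intro p k hk T hT hp
    refine le_trans (Finset.sum_le_sum fun v hv => ?_) (sum_tsub_le_of_mem hk hT)
    rw [Finsupp.add_apply, Finsupp.single_eq_of_ne (ne_of_mem_of_not_mem hv hp), add_zero]
  obtain ⟨y, hy, hyc⟩ := exists_cycle_edge_cover hm (fun v => t - c v) t fun T hT => by
    by_cases h0 : (0 : Fin (m + 2)) ∈ T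
    · exact hsum 1 l hl T hT (by simpa using hT 0 h0)
    · exact hsum 0 k hk T hT h0
  refine (monomial_mem_pow_pred_pred_iff m t c).2 ⟨y, hy, fun v => ?_⟩
  have := hyc v
  omega

theorem depths_eq_zero_of_pred (hm : 1 ≤ m) (ht : m ≤ t) :
    stanleyDepth (cyclePathIdeal K (m + 1) m ^ t) = 0 ∧
      polyDepth K (m + 1) (MvPolynomial (Fin (m + 1)) K ⧸ cyclePathIdeal K (m + 1) m ^ t) = 0 := by
  obtain ⟨s, rfl⟩ := Nat.exists_eq_add_of_le ht
  -- The demands are 1 everywhere plus s at the vertex 0, in total m + 1 + s = t + 1: one too many.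
  let c : Fin (m + 1) →₀ ℕ := Finsupp.equivFunOnFinite.symm fun v =>
    m + s - 1 - (if v = 0 then s else 0)
  have hc : ∀ v, c v + 1 + (if v = 0 then s else 0) = m + s := by
    intro v
    simp only [c, Finsupp.equivFunOnFinite_symm_apply_apply]
    split_ifs <;> omega
  have hnot : monomial c (1 : K) ∉ cyclePathIdeal K (m + 1) m ^ (m + s) := by
    rw [monomial_mem_pow_pred_iff]
    rintro ⟨y, hy, hyc⟩
    have hle : ∑ v : Fin (m + 1), (1 + if v = 0 then s else 0) ≤ ∑ v, y v :=
      Finset.sum_le_sum fun v _ => by have := hyc v; have := hc v; omega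
    simp [Finset.sum_add_distrib] at hle
    omega
  have hin : ∀ i, monomial (c + Finsupp.single i 1) (1 : K) ∈
      cyclePathIdeal K (m + 1) m ^ (m + s) := by
    intro i
    rw [monomial_mem_pow_pred_iff]
    have hy : ∀ v, (1 + (if v = 0 then s else 0) - if v = i then 1 else 0) +
        (if v = i then 1 else 0) = 1 + if v = 0 then s else 0 := by
      intro v
      split_ifs <;> omega
    refine ⟨fun v => 1 + (if v = 0 then s else 0) - if v = i then 1 else 0, ?_, fun v => ?_⟩
    · have := Finset.sum_congr rfl fun v (_ : v ∈ Finset.univ) => hy v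
      rw [Finset.sum_add_distrib, Finset.sum_add_distrib] at this
      simp at this ⊢
      omega
    · have := hc v
      have := hy v
      simp only [Finsupp.add_apply, Finsupp.single_apply, eq_comm (a := i)]
      omega
  refine ⟨?_, polyDepth_eq_zero hnot hin⟩
  rw [← nonpos_iff_eq_zero, ← Nat.cast_zero]
  refine stanleyDepth_le (isMonomialIdeal_cyclePathIdeal_pow _ _ _) hnot fun Z hZ => ?_
  by_contra hne
  obtain ⟨i, hi⟩ := Finset.card_pos.1 (not_le.1 hne)
  exact hZ (Finsupp.single i 1)
    (Finsupp.support_single_subset.trans (Finset.singleton_subset_iff.2 hi)) (hin i)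

theorem depths_eq_zero_of_odd {s h : ℕ} (hm : m + 2 = 2 * h + 1) (ht : s + h = t) (hs : s + 1 ≤ t) :
    stanleyDepth (cyclePathIdeal K (m + 2) m ^ t) = 0 ∧
      polyDepth K (m + 2) (MvPolynomial (Fin (m + 2)) K ⧸ cyclePathIdeal K (m + 2) m ^ t) = 0 := by
  have hm' : Odd m := by rw [Nat.odd_iff]; omega
  obtain ⟨c, hc⟩ := exists_exponent (m := m) hs
  have hnot : monomial c (1 : K) ∉ cyclePathIdeal K (m + 2) m ^ t := by
    rw [monomial_mem_pow_pred_pred_iff]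
    rintro ⟨y, hy, hyc⟩
    -- Total weight t covers at most 2t units, while the demands add up to m + 2 + 2s = 2t + 1.
    have hle : ∑ v : Fin (m + 2), (1 + (if v = 0 then s else 0) + if v = 1 then s else 0) ≤
        ∑ v, (y v + y (v - 1)) :=
      Finset.sum_le_sum fun v _ => by have := hyc v; have := hc v; omega
    rw [sum_add_sum_sub_one, hy] at hle
    simp [Finset.sum_add_distrib] at hle
    omega
  have hin : ∀ i, monomial (c + Finsupp.single i 1) (1 : K) ∈ cyclePathIdeal K (m + 2) m ^ t := by
    intro i
    rw [monomial_mem_pow_pred_pred_iff]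
    obtain ⟨y, hy⟩ := exists_matching_of_odd hm' i
    refine ⟨fun v => y v + if v = 0 then s else 0, ?_, fun v => ?_⟩
    · have h1 := Finset.sum_congr rfl fun v (_ : v ∈ Finset.univ) => hy v
      rw [Finset.sum_add_distrib, sum_add_sum_sub_one] at h1
      rw [Finset.sum_add_distrib]
      simp at h1 ⊢
      omega
    · have := hc v
      have := hy v
      simp only [Finsupp.add_apply, Finsupp.single_apply, eq_comm (a := i), sub_eq_zero]
      omega
  refine ⟨?_, polyDepth_eq_zero hnot hin⟩
  rw [← nonpos_iff_eq_zero, ← Nat.cast_zero]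
  refine stanleyDepth_le (isMonomialIdeal_cyclePathIdeal_pow _ _ _) hnot fun Z hZ => ?_
  by_contra hne
  obtain ⟨i, hi⟩ := Finset.card_pos.1 (not_le.1 hne)
  exact hZ (Finsupp.single i 1)
    (Finsupp.support_single_subset.trans (Finset.singleton_subset_iff.2 hi)) (hin i)

/-- On an even cycle there is a monomial that leaves the power of the path ideal in the directions
of either colour class, but in no direction that involves both. -/
theorem exists_disconnecting_monomial {s h : ℕ} (hm : m + 2 = 2 * h) (hh : 2 ≤ h)
    (ht : s + h = t + 1) : ∃ c : Fin (m + 2) →₀ ℕ,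
      (∀ e : Fin (m + 2) →₀ ℕ, ((∀ v ∈ e.support, Even v.val) ∨ ∀ v ∈ e.support, ¬ Even v.val) →
        monomial (c + e) (1 : K) ∉ cyclePathIdeal K (m + 2) m ^ t) ∧
      ∀ i j : Fin (m + 2), Even i.val → ¬ Even j.val →
        monomial (c + Finsupp.single i 1 + Finsupp.single j 1) (1 : K) ∈
          cyclePathIdeal K (m + 2) m ^ t := by
  have hm' : Even m := by rw [Nat.even_iff]; omega
  have hpar := even_val_add_one_iff hm'
  obtain ⟨c, hc⟩ := exists_exponent (m := m) (s := s) (t := t) (by omega)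
  refine ⟨c, ?_, fun i j hi hj => ?_⟩
  -- T will be the colour class untouched by e. It has h vertices and contains exactly one of 0 and
  -- 1, so its demand is h + s = t + 1, too much for an independent set.
  · have key : ∀ (e : Fin (m + 2) →₀ ℕ) (T : Finset (Fin (m + 2))) (p : Fin (m + 2)),
        (∀ v ∈ T, v + 1 ∉ T) → T.card = h → p ∈ T → (p = 0 ∨ p = 1) → (∀ v ∈ T, e v = 0) →
        monomial (c + e) (1 : K) ∉ cyclePathIdeal K (m + 2) m ^ t := by
      intro e T p hT hcard hpT hp he hmem
      have h1 := sum_tsub_le_of_mem hmem hT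
      have h2 : ∑ v ∈ T, (1 + if v = p then s else 0) ≤ ∑ v ∈ T, (t - (c + e) v) := by
        refine Finset.sum_le_sum fun v hv => ?_
        rw [Finsupp.add_apply, he v hv]
        have := hc v
        split_ifs with hvp
        · rw [← hvp] at hp
          rcases hp with hp | hp <;> simp only [hp, if_true] at this ⊢ <;> omega
        · omega
      rw [Finset.sum_add_distrib, Finset.sum_ite_eq', if_pos hpT, Finset.sum_const, hcard,
        smul_eq_mul, mul_one] at h2
      omega
    obtain ⟨he, ho⟩ := card_even_eq hm
    rintro e (h | h)
    · refine key e _ 1 (fun v hv => ?_) ho ?_ (Or.inr rfl) fun v hv => ?_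
      · simpa [hpar] using hv
      · simp
      · by_contra hne
        exact (Finset.mem_filter.1 hv).2 (h v (Finsupp.mem_support_iff.2 hne))
    · refine key e _ 0 (fun v hv => ?_) he ?_ (Or.inl rfl) fun v hv => ?_
      · simpa [hpar] using hv
      · simp
      · by_contra hne
        exact h v (Finsupp.mem_support_iff.2 hne) (Finset.mem_filter.1 hv).2
  · rw [monomial_mem_pow_pred_pred_iff]
    obtain ⟨y, hy⟩ := exists_matching_of_even hm' hi hj
    -- The matching has h - 1 edges, and weight s on {0, 1} brings the total to t.
    refine ⟨fun v => y v + if v = 0 then s else 0, ?_, fun v => ?_⟩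
    · have h1 := Finset.sum_congr rfl fun v (_ : v ∈ Finset.univ) => hy v
      rw [Finset.sum_add_distrib, Finset.sum_add_distrib, sum_add_sum_sub_one] at h1
      rw [Finset.sum_add_distrib]
      simp at h1 ⊢
      omega
    · have := hc v
      have := hy v
      simp only [Finsupp.add_apply, Finsupp.single_apply, eq_comm (a := i), eq_comm (a := j),
        sub_eq_zero]
      omega

theorem depths_of_even {s h : ℕ} (hm : m + 2 = 2 * h) (hh : 2 ≤ h) (ht : s + h = t + 1) :
    stanleyDepth (cyclePathIdeal K (m + 2) m ^ t) ≤ h ∧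
      1 ≤ stanleyDepth (cyclePathIdeal K (m + 2) m ^ t) ∧
      polyDepth K (m + 2) (MvPolynomial (Fin (m + 2)) K ⧸ cyclePathIdeal K (m + 2) m ^ t) = 1 := by
  have hm' : Even m := by rw [Nat.even_iff]; omega
  have hI := isMonomialIdeal_cyclePathIdeal_pow (K := K) (m + 2) m t
  obtain ⟨c, hnot, hin⟩ := exists_disconnecting_monomial (K := K) hm hh ht
  have hdir : ∀ c : Fin (m + 2) →₀ ℕ, monomial c (1 : K) ∉ cyclePathIdeal K (m + 2) m ^ t →
      (∀ k, monomial (c + Finsupp.single 0 k) (1 : K) ∉ cyclePathIdeal K (m + 2) m ^ t) ∨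
        ∀ k, monomial (c + Finsupp.single 1 k) (1 : K) ∉ cyclePathIdeal K (m + 2) m ^ t := by
    intro c hc
    by_contra! hbad
    obtain ⟨⟨k, hk⟩, l, hl⟩ := hbad
    exact hc (mem_of_mem_saturations hm' hk hl)
  refine ⟨?_, ?_, le_antisymm ?_ ?_⟩
  · refine stanleyDepth_le hI (c := c) (by simpa using hnot 0 (by simp)) fun Z hZ => ?_
    obtain ⟨he, ho⟩ := card_even_eq hm
    -- A set Z meeting both colour classes would allow a step into the ideal, so Z lies in one class
    -- of size h.
    by_cases hZe : ∀ v ∈ Z, Even v.val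
    · rw [← he]
      exact Finset.card_le_card fun v hv => by simpa using hZe v hv
    · push Not at hZe
      obtain ⟨j, hj, hjo⟩ := hZe
      rw [← ho]
      refine Finset.card_le_card fun i hi => ?_
      rw [Finset.mem_filter]
      refine ⟨Finset.mem_univ _, fun hie => hZ (Finsupp.single i 1 + Finsupp.single j 1) ?_ ?_⟩
      · refine Finsupp.support_add.trans (Finset.union_subset ?_ ?_) <;>
          exact Finsupp.support_single_subset.trans (Finset.singleton_subset_iff.2 ‹_›)
      · rw [← add_assoc]
        exact hin i j hie (by simpa using hjo)
  · refine one_le_stanleyDepth hI t (fun c d hcd hc => ?_) fun c hc => ?_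
    · rw [monomial_mem_pow_pred_pred_iff] at hc ⊢
      obtain ⟨y, hy, hyc⟩ := hc
      refine ⟨y, hy, fun v => ?_⟩
      have := hcd v
      have := hyc v
      omega
    · rcases hdir c hc with h | h
      exacts [⟨0, h⟩, ⟨1, h⟩]
  · refine polyDepth_le_one hI (c := c) {v | Even v.val} (i₀ := 0) (j₀ := 1) (by simp) (by simp)
      (hnot _ (Or.inl ?_)) (hnot _ (Or.inr ?_)) fun i hi j hj => hin i j hi hj
    all_goals
      intro v hv
      rw [Finset.mem_singleton.1 (Finsupp.support_single_subset hv)]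
      simp
  · refine one_le_polyDepth (f := X 0 + X 1) ?_ ?_ fun g hg =>
      mem_of_X_add_X_mul_mem hI zero_ne_one hdir hg
    · exact (Ideal.pow_le_self (by omega)).trans (cyclePathIdeal_le_span_X (by omega))
    · exact Ideal.add_mem _ (Ideal.subset_span ⟨_, rfl⟩) (Ideal.subset_span ⟨_, rfl⟩)

end CycleDepth

theorem theorem2p2 (K : Type*) [Field K] (n t : ℕ) :
    (2 ≤ n → n - 1 ≤ t →
      stanleyDepth (cyclePathIdeal K n (n - 1) ^ t) = 0 ∧
      polyDepth K n (MvPolynomial (Fin n) K ⧸ cyclePathIdeal K n (n - 1) ^ t) = 0) ∧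
    (3 ≤ n → Odd n → (n - 1) / 2 ≤ t →
      stanleyDepth (cyclePathIdeal K n (n - 2) ^ t) = 0 ∧
      polyDepth K n (MvPolynomial (Fin n) K ⧸ cyclePathIdeal K n (n - 2) ^ t) = 0) ∧
    (3 ≤ n → Even n → n - 1 ≤ t →
      stanleyDepth (cyclePathIdeal K n (n - 2) ^ t) ≤ ((n / 2 : ℕ) : ℕ∞) ∧
      polyDepth K n (MvPolynomial (Fin n) K ⧸ cyclePathIdeal K n (n - 2) ^ t) ≤
        stanleyDepth (cyclePathIdeal K n (n - 2) ^ t) ∧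
      polyDepth K n (MvPolynomial (Fin n) K ⧸ cyclePathIdeal K n (n - 2) ^ t) = 1) := by
  refine ⟨fun hn ht => ?_, fun hn hodd ht => ?_, fun hn heven ht => ?_⟩
  · obtain ⟨m, rfl⟩ := Nat.exists_eq_add_of_le' (show 1 ≤ n by omega)
    exact depths_eq_zero_of_pred (by omega) (by simpa using ht)
  · obtain ⟨m, rfl⟩ := Nat.exists_eq_add_of_le' (show 2 ≤ n by omega)
    rw [Nat.odd_iff] at hodd
    exact depths_eq_zero_of_odd (s := t - (m + 1) / 2) (h := (m + 1) / 2) (by omega) (by omega)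
      (by omega)
  · obtain ⟨m, rfl⟩ := Nat.exists_eq_add_of_le' (show 2 ≤ n by omega)
    rw [Nat.even_iff] at heven
    obtain ⟨h1, h2, h3⟩ := depths_of_even (K := K) (m := m) (t := t) (s := t + 1 - (m + 2) / 2)
      (h := (m + 2) / 2) (by omega) (by omega) (by omega)
    exact ⟨h1, h3.le.trans h2, h3⟩
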